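/- Let $\mathcal{A}$ be a σ-field of subsets of a set $X$. Let $\mathcal{M}(X,\mathcal{A})$ be the ring, under pointwise addition and multiplication, of all functions $f\colon X\to\mathbb{R}$ such that $f^{-1}(U)\in\mathcal{A}$ for every open $U\subseteq\mathbb{R}$. For a commutative ring $R$, let $\mathrm{Soc}(R)$ be the sum of all nonzero minimal ideals of $R$, and call $R$ self-injective if every $R$-module homomorphism $I\to R$ from an ideal $I$ of $R$ extends to an $R$-module homomorphism $R\to R$. Then the ring $\mathcal{M}(X,\mathcal{A})/\mathrm{Soc}(\mathcal{M}(X,\mathcal{A}))$ is self-injective if and only if all of the following hold: 1. $\mathcal{A}$, ordered by inclusion, is a complete Boolean algebra, i.e. every nonempty subset of $\mathcal{A}$ has a supremum in $\mathcal{A}$; 2. $\mathcal{A}$ is $\mathfrak{c}^+$-additive, i.e. $\bigcup_{i\in I}A_i\in\mathcal{A}$ for every family $(A_i)_{i\in I}$ of members of $\mathcal{A}$ with $|I|\le\mathfrak{c}=2^{\aleph_0}$; 3. $\mathcal{A}$ has only finitely many atoms, an atom being a nonempty $A\in\mathcal{A}$ such that the only nonempty $B\in\mathcal{A}$ with $B\subseteq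 A$ is $A$ itself. -/

import Mathlib

universe u

/-- The ring `M(X, 𝒜)` of real-valued `𝒜`-measurable functions on `X`, where the σ-field `𝒜` is
given as a `MeasurableSpace` structure on `X`: the functions `f : X → ℝ` such that the preimage of
every open subset of `ℝ` belongs to `𝒜`, with pointwise operations. -/
def measurableFunctionRing (X : Type u) [MeasurableSpace X] : Subring (X → ℝ) where
  carrier := {f | ∀ U : Set ℝ, IsOpen U → MeasurableSet (f ⁻¹' U)}
  mul_mem' {f g} hf hg U hU :=
    (measurable_of_isOpen hf).mul (measurable_of_isOpen hg) hU.measurableSet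
  one_mem' U hU := (measurable_const : Measurable fun _ : X => (1 : ℝ)) hU.measurableSet
  add_mem' {f g} hf hg U hU :=
    (measurable_of_isOpen hf).add (measurable_of_isOpen hg) hU.measurableSet
  zero_mem' U hU := (measurable_const : Measurable fun _ : X => (0 : ℝ)) hU.measurableSet
  neg_mem' {f} hf U hU := (measurable_of_isOpen hf).neg hU.measurableSet

/-- The socle of a commutative ring: the sum of all (nonzero) minimal ideals. -/
def ringSocle (R : Type u) [CommRing R] : Ideal R :=
  sSup {I : Ideal R | IsAtom I}

/-- A commutative ring `R` is self-injective if every module homomorphism from an ideal of `R`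
to `R` extends to a module homomorphism `R → R`. -/
def IsSelfInjectiveRing (R : Type u) [CommRing R] : Prop :=
  Module.Baer R R

/-- A Boolean algebra is complete if every nonempty subset has a supremum. -/
def IsCompleteBooleanAlgebra (B : Type u) [BooleanAlgebra B] : Prop :=
  ∀ K : Set B, K.Nonempty → ∃ x : B, IsLUB K x

/-- The σ-field of `X` is `κ⁺`-additive if the set-theoretic union of every family of at most `κ`
of its members is again a member. -/
def IsSuccAdditive (X : Type u) [MeasurableSpace X] (κ : Cardinal.{u}) : Prop :=
  ∀ (ι : Type u) (A : ι → Set X), Cardinal.mk ι ≤ κ → (∀ i, MeasurableSet (A i)) →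
    MeasurableSet (⋃ i, A i)

/-- The σ-field of `X` as a Boolean algebra, ordered by inclusion. -/
abbrev SigmaFieldAlgebra (X : Type u) [MeasurableSpace X] : Type u :=
  {s : Set X // MeasurableSet s}

/-! Modulo the socle, a function is known up to its values on finitely many atoms (`ringSocle_eq`).
The quotient is reduced, so self-injectivity yields an `f` that is an identity on prescribed
characteristic functions and kills whatever annihilates them. With infinitely many atoms a diagonal
argument contradicts this (`finite_setOf_isAtom`); with finitely many, the cozero set of `f`,
corrected on the atoms, is a supremum. Completeness alone forces additivity for the continuum:
binary labels on a disjoint family reduce its supremum to countable intersections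
(`exists_mem_of_mem_sup_of_disjoint`). Conversely, a homomorphism from an ideal is given by
compatible local functions, and completeness glues them into a single multiplier
(`exists_measurable_glue`). -/

/-- Over a reduced self-injective ring, some element acts as the identity on a given set and kills
everything which annihilates that set. -/
theorem IsSelfInjectiveRing.exists_mul_eq_self {R : Type u} [CommRing R] [IsReduced R]
    (hR : IsSelfInjectiveRing R) (K : Set R) :
    ∃ f : R, (∀ e ∈ K, f * e = e) ∧ ∀ c, (∀ e ∈ K, c * e = 0) → f * c = 0 := by
  let I₂ : Ideal R :=
    { carrier := {c | ∀ e ∈ K, c * e = 0}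
      add_mem' := fun {a b} ha hb e he => by rw [add_mul, ha e he, hb e he, add_zero]
      zero_mem' := fun e _ => zero_mul e
      smul_mem' := fun r c hc e he => by rw [smul_eq_mul, mul_assoc, hc e he, mul_zero] }
  let p₁ : R →ₗ.[R] R := ⟨Ideal.span K, (Ideal.span K).subtype⟩
  let p₂ : R →ₗ.[R] R := ⟨I₂, 0⟩
  -- The two domains meet only in 0: an element of both squares to 0.
  have compat : ∀ (x : p₁.domain) (y : p₂.domain), (x : R) = y → p₁ x = p₂ y := by
    rintro ⟨x, hx⟩ ⟨y, hy⟩ (rfl : x = y)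
    have hker : Ideal.span K ≤ LinearMap.ker (LinearMap.mulLeft R x) :=
      Ideal.span_le.2 fun e he => hy e he
    have hxx : x * x = 0 := hker hx
    exact IsReduced.eq_zero x ⟨2, by rw [sq, hxx]⟩
  obtain ⟨g, hg⟩ := hR (p₁.sup p₂ compat).domain (p₁.sup p₂ compat).toFun
  have hg1 : ∀ r, g r = g 1 * r := fun r => by
    have := g.map_smul r 1
    rw [smul_eq_mul, smul_eq_mul, mul_one] at this
    rw [this, mul_comm]
  refine ⟨g 1, fun e he => ?_, fun c hc => ?_⟩
  · have hmem : e ∈ p₁.domain := Ideal.subset_span he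
    have hle := p₁.left_le_sup p₂ compat
    rw [← hg1, hg e (hle.1 hmem)]
    exact (hle.2 (x := ⟨e, hmem⟩) rfl).symm
  · have hmem : c ∈ p₂.domain := hc
    have hle := p₁.right_le_sup p₂ compat
    rw [← hg1, hg c (hle.1 hmem)]
    exact (hle.2 (x := ⟨c, hmem⟩) rfl).symm

/-! ### Suprema, unions and gluing in a complete σ-field -/

section SigmaField

variable {X : Type u} [MeasurableSpace X]

theorem IsCompleteBooleanAlgebra.exists_sup
    (h : IsCompleteBooleanAlgebra (SigmaFieldAlgebra X)) (K : Set (Set X))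
    (hK : ∀ B ∈ K, MeasurableSet B) :
    ∃ S, MeasurableSet S ∧ (∀ B ∈ K, B ⊆ S) ∧
      ∀ T, MeasurableSet T → (∀ B ∈ K, B ⊆ T) → S ⊆ T := by
  -- Adding `⊥` covers empty `K` without changing upper bounds.
  obtain ⟨S, hS⟩ := h (insert ⊥ {B | (B : Set X) ∈ K}) (Set.insert_nonempty _ _)
  refine ⟨S, S.2, fun B hB => @hS.1 ⟨B, hK B hB⟩ (Or.inr hB), fun T hT hKT => ?_⟩
  refine hS.2 (show (⟨T, hT⟩ : SigmaFieldAlgebra X) ∈ _ from ?_)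
  rintro B (rfl | hB)
  · exact bot_le
  · exact hKT B hB

/-- In a complete σ-field, the supremum of a disjoint family of at most continuum many members is
its union. -/
theorem exists_mem_of_mem_sup_of_disjoint
    (h : IsCompleteBooleanAlgebra (SigmaFieldAlgebra X)) {ι : Type u} (g : ι → ℕ → Bool)
    (hg : Function.Injective g) (B : ι → Set X) (hB : ∀ i, MeasurableSet (B i))
    (hdisj : ∀ i j, i ≠ j → Disjoint (B i) (B j)) {S : Set X}
    (hmin : ∀ T, MeasurableSet T → (∀ i, B i ⊆ T) → S ⊆ T) {x : X} (hx : x ∈ S) :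
    ∃ i, x ∈ B i := by
  have hsup : ∀ J : Set ι, ∃ T, MeasurableSet T ∧ (∀ i ∈ J, B i ⊆ T) ∧
      ∀ i ∉ J, Disjoint (B i) T := by
    intro J
    obtain ⟨T, hT, hup, hle⟩ := h.exists_sup (B '' J) (by rintro _ ⟨i, -, rfl⟩; exact hB i)
    refine ⟨T, hT, fun i hi => hup _ ⟨i, hi, rfl⟩, fun i hi => ?_⟩
    have := hle (B i)ᶜ (hB i).compl (by
      rintro _ ⟨j, hj, rfl⟩
      exact (hdisj j i fun hji => hi (hji ▸ hj)).subset_compl_right)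
    exact (Set.disjoint_left.2 fun y hy => this hy).symm
  choose T hTm hTup hTdisj using hsup
  have hcover : ∀ n, ∃ b, x ∈ T {i | g i n = b} := by
    intro n
    have := hmin (T {i | g i n = true} ∪ T {i | g i n = false}) ((hTm _).union (hTm _)) (by
      intro i
      cases hi : g i n
      · exact (hTup {i | g i n = false} i hi).trans Set.subset_union_right
      · exact (hTup {i | g i n = true} i hi).trans Set.subset_union_left) hx
    exact this.elim (fun h => ⟨_, h⟩) fun h => ⟨_, h⟩
  choose b hb using hcover
  -- `D` contains `x` and meets only the member labelled `b`, if there is one. Removing that member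
  -- leaves a set disjoint from the whole family, hence from `S`.
  set D := ⋂ n, T {i | g i n = b n}
  have hDm : MeasurableSet D := MeasurableSet.iInter fun n => hTm _
  have hxD : x ∈ D := Set.mem_iInter.2 hb
  have hmeet : ∀ i y, y ∈ B i → y ∈ D → g i = b := by
    intro i y hyB hyD
    funext n
    by_contra hne
    exact Set.disjoint_left.1 (hTdisj {i | g i n = b n} i hne) hyB (Set.mem_iInter.1 hyD n)
  by_contra! hxB
  by_cases hi : ∃ i, g i = b
  · obtain ⟨i, hi⟩ := hi
    refine hmin (D \ B i)ᶜ (hDm.diff (hB i)).compl ?_ hx ⟨hxD, hxB i⟩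
    rintro j y hyj ⟨hyD, hyi⟩
    have : j = i := hg ((hmeet j y hyj hyD).trans hi.symm)
    exact hyi (this ▸ hyj)
  · push Not at hi
    exact hmin Dᶜ hDm.compl (fun i y hyi hyD => hi i (hmeet i y hyi hyD)) hx hxD

/-- A complete σ-field is closed under unions of continuum many members. -/
theorem IsCompleteBooleanAlgebra.isSuccAdditive_continuum
    (h : IsCompleteBooleanAlgebra (SigmaFieldAlgebra X)) :
    IsSuccAdditive X Cardinal.continuum.{u} := by
  intro ι A hι hA
  obtain ⟨g, hg⟩ : ∃ g : ι → ℕ → Bool, Function.Injective g := by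
    have hc : Cardinal.mk ι ≤ Cardinal.mk (ULift.{u} (ℕ → Bool)) := by
      rw [Cardinal.mk_uLift]
      simpa using hι
    obtain ⟨e⟩ := hc
    exact ⟨fun i => (e i).down, fun i j hij => e.injective (ULift.down_injective hij)⟩
  -- `T i` is the supremum of the earlier members, so the sets `A i \ T i` are disjoint; by
  -- well-founded induction they have the same upper bounds as the `A i`.
  have hsup : ∀ i, ∃ T, MeasurableSet T ∧ (∀ j, WellOrderingRel j i → A j ⊆ T) ∧
      ∀ U, MeasurableSet U → (∀ j, WellOrderingRel j i → A j ⊆ U) → T ⊆ U := by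
    intro i
    obtain ⟨T, hT, hup, hle⟩ := h.exists_sup (A '' {j | WellOrderingRel j i})
      (by rintro _ ⟨j, -, rfl⟩; exact hA j)
    exact ⟨T, hT, fun j hj => hup _ ⟨j, hj, rfl⟩, fun U hU hj =>
      hle U hU (by rintro _ ⟨j, hji, rfl⟩; exact hj j hji)⟩
  choose T hTm hTup hTle using hsup
  have hdisj : ∀ i j, WellOrderingRel i j → Disjoint (A i \ T i) (A j \ T j) := fun i j hij =>
    Set.disjoint_left.2 fun y hyi hyj => hyj.2 (hTup j i hij hyi.1)
  obtain ⟨S, hS, hup, hle⟩ := h.exists_sup (Set.range A) (by rintro _ ⟨i, rfl⟩; exact hA i)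
  suffices hSA : S = ⋃ i, A i by rwa [← hSA]
  refine Set.Subset.antisymm (fun x hx => ?_) (Set.iUnion_subset fun i => hup _ ⟨i, rfl⟩)
  obtain ⟨i, hi⟩ := exists_mem_of_mem_sup_of_disjoint h g hg (fun i => A i \ T i)
    (fun i => (hA i).diff (hTm i)) (fun i j hij => by
      rcases trichotomous_of WellOrderingRel i j with h1 | h1 | h1
      · exact hdisj i j h1
      · exact absurd h1 hij
      · exact (hdisj j i h1).symm) (fun U hU hAU => hle U hU (by
        rintro _ ⟨i, rfl⟩
        induction i using WellOrderingRel.isWellOrder.wf.induction with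
        | _ i ih =>
          intro y hy
          by_cases hyT : y ∈ T i
          · exact hTle i U hU ih hyT
          · exact hAU i ⟨hy, hyT⟩)) hx
  exact Set.mem_iUnion.2 ⟨i, hi.1⟩

/-- Compatible measurable functions on members of a complete σ-field have a common measurable
extension. -/
theorem IsCompleteBooleanAlgebra.exists_measurable_glue
    (h : IsCompleteBooleanAlgebra (SigmaFieldAlgebra X)) {ι : Type*} (B : ι → Set X)
    (hB : ∀ i, MeasurableSet (B i)) (f : ι → X → ℝ) (hf : ∀ i, Measurable (f i))
    (hcompat : ∀ i j, ∀ x ∈ B i, x ∈ B j → f i x = f j x) :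
    ∃ F : X → ℝ, Measurable F ∧ ∀ i, ∀ x ∈ B i, F x = f i x := by
  have hlt : ∀ i (r : ℚ), MeasurableSet {x | f i x < r} := fun i r =>
    measurableSet_lt (hf i) measurable_const
  have hsup : ∀ r : ℚ, ∃ E, MeasurableSet E ∧ ∀ i, ∀ x ∈ B i, x ∈ E ↔ f i x < r := by
    intro r
    obtain ⟨E, hE, hup, hle⟩ := h.exists_sup (Set.range fun i => B i ∩ {x | f i x < r})
      (by rintro _ ⟨i, rfl⟩; exact (hB i).inter (hlt i r))
    refine ⟨E, hE, fun i x hx => ⟨fun hxE => ?_, fun hxr => hup _ ⟨i, rfl⟩ ⟨hx, hxr⟩⟩⟩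
    by_contra hxr
    refine hle (B i \ {x | f i x < r})ᶜ ((hB i).diff (hlt i r)).compl ?_ hxE ⟨hx, hxr⟩
    rintro _ ⟨j, rfl⟩ y ⟨hyj, hyr⟩ ⟨hyi, hyn⟩
    exact hyn ((hcompat i j y hyi hyj).trans_lt hyr)
  choose E hE hEB using hsup
  classical
  -- `E r` plays the role of the sublevel set at `r`; the infimum recovers the value on each `B i`.
  -- Infinite values, possible only elsewhere, become 0.
  refine ⟨fun x => (⨅ r : ℚ, if x ∈ E r then ((r : ℝ) : EReal) else ⊤).toReal, ?_, ?_⟩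
  · exact (Measurable.iInf fun r =>
      Measurable.ite (hE r) measurable_const measurable_const).ereal_toReal
  · intro i x hx
    have : (⨅ r : ℚ, if x ∈ E r then ((r : ℝ) : EReal) else ⊤) = (f i x : EReal) := by
      refine le_antisymm (le_of_forall_gt fun c hc => ?_) (le_iInf fun r => ?_)
      · obtain ⟨r, hr, hrc⟩ := EReal.lt_iff_exists_rat_btwn.1 hc
        refine lt_of_le_of_lt (iInf_le _ r) ?_
        rw [if_pos ((hEB r i x hx).2 (by exact_mod_cast hr))]
        exact hrc
      · split_ifs with hr
        · exact_mod_cast ((hEB r i x hx).1 hr).le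
        · exact le_top
    simp only [this, EReal.toReal_coe]

end SigmaField

/-! ### Measurable functions, cozero sets and the socle -/

section FunctionRing

variable {X : Type u} [MeasurableSpace X]

namespace measurableFunctionRing

theorem measurable_coe (f : measurableFunctionRing X) : Measurable (f : X → ℝ) :=
  measurable_of_isOpen f.2

/-- A measurable function as an element of the ring of measurable functions. -/
def ofMeasurable (f : X → ℝ) (hf : Measurable f) : measurableFunctionRing X :=
  ⟨f, fun _ hU => hf hU.measurableSet⟩

/-- The characteristic function of a member of the σ-field. -/
noncomputable def char (s : SigmaFieldAlgebra X) : measurableFunctionRing X :=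
  ofMeasurable ((s : Set X).indicator 1) (measurable_one.indicator s.2)

/-- The pointwise inverse, which is `0` at the zeros. -/
noncomputable def pinv (f : measurableFunctionRing X) : measurableFunctionRing X :=
  ofMeasurable (fun x => ((f : X → ℝ) x)⁻¹) (measurable_coe f).inv

/-- The cozero set. -/
def coz (f : measurableFunctionRing X) : SigmaFieldAlgebra X :=
  ⟨{x | (f : X → ℝ) x ≠ 0},
    (measurable_coe f) (measurableSet_singleton (0 : ℝ)).compl⟩

theorem mem_coz {f : measurableFunctionRing X} {x : X} :
    x ∈ (coz f : Set X) ↔ (f : X → ℝ) x ≠ 0 := Iff.rfl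

theorem coe_mul_apply (f g : measurableFunctionRing X) (x : X) :
    ((f * g : measurableFunctionRing X) : X → ℝ) x = (f : X → ℝ) x * (g : X → ℝ) x := rfl

theorem coe_sub_apply (f g : measurableFunctionRing X) (x : X) :
    ((f - g : measurableFunctionRing X) : X → ℝ) x = (f : X → ℝ) x - (g : X → ℝ) x := rfl

theorem coe_add_apply (f g : measurableFunctionRing X) (x : X) :
    ((f + g : measurableFunctionRing X) : X → ℝ) x = (f : X → ℝ) x + (g : X → ℝ) x := rfl

theorem coe_zero_apply (x : X) : ((0 : measurableFunctionRing X) : X → ℝ) x = 0 := rfl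

theorem coe_pinv_apply (f : measurableFunctionRing X) (x : X) :
    (pinv f : X → ℝ) x = ((f : X → ℝ) x)⁻¹ := rfl

theorem char_of_mem {s : SigmaFieldAlgebra X} {x : X} (h : x ∈ (s : Set X)) :
    (char s : X → ℝ) x = 1 := Set.indicator_of_mem h 1

theorem char_of_notMem {s : SigmaFieldAlgebra X} {x : X} (h : x ∉ (s : Set X)) :
    (char s : X → ℝ) x = 0 := Set.indicator_of_notMem h 1

theorem ext_apply {f g : measurableFunctionRing X}
    (h : ∀ x, (f : X → ℝ) x = (g : X → ℝ) x) : f = g := Subtype.ext (funext h)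

theorem mul_char_eq_self {f : measurableFunctionRing X} {s : SigmaFieldAlgebra X}
    (h : coz f ≤ s) : f * char s = f := ext_apply fun x => by
  rw [coe_mul_apply]
  by_cases hx : x ∈ (s : Set X)
  · rw [char_of_mem hx, mul_one]
  · rw [char_of_notMem hx, mul_zero, not_not.1 fun hne => hx (h (mem_coz.2 hne))]

theorem mul_pinv_eq_char (f : measurableFunctionRing X) : f * pinv f = char (coz f) :=
  ext_apply fun x => by
    rw [coe_mul_apply, coe_pinv_apply]
    by_cases hx : x ∈ (coz f : Set X)
    · rw [char_of_mem hx, mul_inv_cancel₀ hx]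
    · rw [char_of_notMem hx, not_not.1 hx, zero_mul]

theorem coz_char (s : SigmaFieldAlgebra X) : coz (char s) = s := by
  refine Subtype.ext (Set.ext fun x => ?_)
  rw [mem_coz]
  by_cases hx : x ∈ (s : Set X)
  · simp [char_of_mem hx, hx]
  · simp [char_of_notMem hx, hx]

theorem coz_eq_bot {f : measurableFunctionRing X} : coz f = ⊥ ↔ f = 0 := by
  refine ⟨fun h => ext_apply fun x => ?_, ?_⟩
  · by_contra hx
    have : x ∈ (coz f : Set X) := mem_coz.2 hx
    rw [h] at this
    exact this
  · rintro rfl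
    exact Subtype.ext (Set.ext fun x => by simp [coz, coe_zero_apply])

theorem coz_mul_le (f g : measurableFunctionRing X) : coz (f * g) ≤ coz g := fun _ hx h0 =>
  hx (by rw [coe_mul_apply, h0, mul_zero])

/-- The functions whose cozero set is covered by finitely many atoms. -/
def finiteAtomIdeal (X : Type u) [MeasurableSpace X] : Ideal (measurableFunctionRing X) where
  carrier := {f | ∃ F : Finset (SigmaFieldAlgebra X), (∀ a ∈ F, IsAtom a) ∧ coz f ≤ F.sup id}
  add_mem' := by
    classical
    rintro f g ⟨F, hF, hf⟩ ⟨G, hG, hg⟩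
    refine ⟨F ∪ G, fun a ha => (Finset.mem_union.1 ha).elim (hF a) (hG a), ?_⟩
    rw [Finset.sup_union]
    refine le_trans ?_ (sup_le_sup hf hg)
    intro x hx
    by_cases h0 : (f : X → ℝ) x = 0
    · exact Or.inr fun h1 => hx (by rw [coe_add_apply, h0, h1, add_zero])
    · exact Or.inl h0
  zero_mem' := ⟨∅, by simp, by rw [coz_eq_bot.2 rfl]; exact bot_le⟩
  smul_mem' := by
    rintro r f ⟨F, hF, hf⟩
    exact ⟨F, hF, (coz_mul_le r f).trans hf⟩

theorem char_mem_ringSocle {a : SigmaFieldAlgebra X} (ha : IsAtom a) :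
    char a ∈ ringSocle (measurableFunctionRing X) := by
  have hatom : IsAtom (Ideal.span {char a} : Ideal (measurableFunctionRing X)) := by
    refine ⟨fun h => ha.1 ?_, fun J hJ => ?_⟩
    · rw [Ideal.span_singleton_eq_bot] at h
      rw [← coz_char a, h, coz_eq_bot]
    · by_contra hne
      obtain ⟨f, hfJ, hf0⟩ := Submodule.exists_mem_ne_zero_of_ne_bot hne
      refine hJ.not_ge (Ideal.span_le.2 (Set.singleton_subset_iff.2 ?_))
      obtain ⟨k, rfl⟩ := Ideal.mem_span_singleton'.1 (hJ.le hfJ)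
      have hle : coz (k * char a) ≤ a := (coz_mul_le k _).trans (coz_char a).le
      have : coz (k * char a) = a :=
        (ha.le_iff.1 hle).resolve_left fun h => hf0 (coz_eq_bot.1 h)
      have h2 := mul_pinv_eq_char (k * char a)
      rw [this] at h2
      rw [SetLike.mem_coe, ← h2]
      exact J.mul_mem_right _ hfJ
  exact (le_sSup hatom : _ ≤ ringSocle _) (Ideal.mem_span_singleton_self _)

/-- A smaller nonempty cozero set would generate a nonzero ideal strictly inside `I`. -/
theorem isAtom_coz_of_mem {I : Ideal (measurableFunctionRing X)} (hI : IsAtom I)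
    {f : measurableFunctionRing X} (hf : f ∈ I) (hf0 : f ≠ 0) : IsAtom (coz f) := by
  refine ⟨fun h => hf0 (coz_eq_bot.1 h), fun B hB => ?_⟩
  by_contra hB0
  have hmem : char B ∈ I := by
    have : char B = char B * char (coz f) := (mul_char_eq_self (by rw [coz_char]; exact hB.le)).symm
    rw [this, ← mul_pinv_eq_char]
    exact I.mul_mem_left _ (I.mul_mem_right _ hf)
  have hne : Ideal.span {char B} ≠ ⊥ := fun h => hB0 (by
    rw [Ideal.span_singleton_eq_bot] at h
    rw [← coz_char B, h, coz_eq_bot])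
  have hspan : Ideal.span {char B} = I :=
    (hI.le_iff.1 (Ideal.span_le.2 (Set.singleton_subset_iff.2 hmem))).resolve_left hne
  rw [← hspan] at hf
  obtain ⟨k, rfl⟩ := Ideal.mem_span_singleton'.1 hf
  exact hB.not_ge ((coz_mul_le k _).trans (coz_char B).le)

theorem ringSocle_eq : ringSocle (measurableFunctionRing X) = finiteAtomIdeal X := by
  classical
  refine le_antisymm (sSup_le fun I hI f hf => ?_) ?_
  · by_cases hf0 : f = 0
    · exact hf0 ▸ Ideal.zero_mem _
    · exact ⟨{coz f}, by simpa using isAtom_coz_of_mem hI hf hf0, by simp⟩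
  · rintro f ⟨F, hF, hf⟩
    rw [← mul_char_eq_self hf]
    refine Ideal.mul_mem_left _ _ ?_
    clear hf f
    induction F using Finset.induction_on with
    | empty =>
      have : char (⊥ : SigmaFieldAlgebra X) = 0 := by rw [← coz_eq_bot, coz_char]
      rw [Finset.sup_empty, this]
      exact Ideal.zero_mem _
    | insert a F haF ih =>
      rw [Finset.sup_insert, id]
      have hchar : ∀ s t : SigmaFieldAlgebra X,
          char (s ⊔ t) = char s + (1 - char s) * char t := fun s t => ext_apply fun x => by
        change Set.indicator (s ∪ t : Set X) (1 : X → ℝ) x =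
          Set.indicator (s : Set X) (1 : X → ℝ) x + (1 - Set.indicator (s : Set X) (1 : X → ℝ) x) *
            Set.indicator (t : Set X) (1 : X → ℝ) x
        by_cases h1 : x ∈ (s : Set X) <;> by_cases h2 : x ∈ (t : Set X) <;> simp [h1, h2]
      rw [hchar]
      exact Ideal.add_mem _ (char_mem_ringSocle (hF a (Finset.mem_insert_self _ _)))
        (Ideal.mul_mem_left _ _ (ih fun b hb => hF b (Finset.mem_insert_of_mem hb)))

theorem mem_ringSocle {f : measurableFunctionRing X} :
    f ∈ ringSocle (measurableFunctionRing X) ↔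
      ∃ F : Finset (SigmaFieldAlgebra X), (∀ a ∈ F, IsAtom a) ∧ coz f ≤ F.sup id := by
  rw [ringSocle_eq]
  rfl

instance isReduced_quotient_ringSocle :
    IsReduced (measurableFunctionRing X ⧸ ringSocle (measurableFunctionRing X)) := by
  refine (Ideal.isRadical_iff_quotient_reduced _).1 ?_
  rintro f ⟨n, hn⟩
  rw [mem_ringSocle] at hn ⊢
  obtain ⟨F, hF, hf⟩ := hn
  refine ⟨F, hF, le_trans (fun x hx => ?_) hf⟩
  exact pow_ne_zero n hx

/-! ### Consequences of self-injectivity -/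

theorem exists_of_isSelfInjectiveRing
    (h : IsSelfInjectiveRing (measurableFunctionRing X ⧸ ringSocle (measurableFunctionRing X)))
    (K : Set (SigmaFieldAlgebra X)) :
    ∃ f : measurableFunctionRing X,
      (∀ B ∈ K, f * char B - char B ∈ ringSocle (measurableFunctionRing X)) ∧
      ∀ C, (∀ B ∈ K, char C * char B ∈ ringSocle (measurableFunctionRing X)) →
        f * char C ∈ ringSocle (measurableFunctionRing X) := by
  obtain ⟨q, hq1, hq2⟩ := h.exists_mul_eq_self ((fun B => Ideal.Quotient.mk _ (char B)) '' K)
  obtain ⟨f, rfl⟩ := Ideal.Quotient.mk_surjective q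
  refine ⟨f, fun B hB => ?_, fun C hC => ?_⟩
  · rw [← Ideal.Quotient.eq, map_mul]
    exact hq1 _ ⟨B, hB, rfl⟩
  · rw [← Ideal.Quotient.eq_zero_iff_mem, map_mul]
    refine hq2 _ ?_
    rintro _ ⟨B, hB, rfl⟩
    rw [← map_mul]
    exact Ideal.Quotient.eq_zero_iff_mem.2 (hC B hB)

theorem atom_le {a s : SigmaFieldAlgebra X} (ha : IsAtom a) {x : X} (hx : x ∈ (a : Set X))
    (hs : x ∈ (s : Set X)) : a ≤ s := by
  rcases ha.le_iff.1 (inf_le_left : a ⊓ s ≤ a) with h | h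
  · have : x ∈ ((a ⊓ s : SigmaFieldAlgebra X) : Set X) := ⟨hx, hs⟩
    rw [h] at this
    exact this.elim
  · exact inf_eq_left.1 h

theorem atom_eq {a b : SigmaFieldAlgebra X} (ha : IsAtom a) (hb : IsAtom b) {x : X}
    (hx : x ∈ (a : Set X)) (hb' : x ∈ (b : Set X)) : a = b :=
  le_antisymm (atom_le ha hx hb') (atom_le hb hb' hx)

theorem atom_nonempty {a : SigmaFieldAlgebra X} (ha : IsAtom a) : (a : Set X).Nonempty :=
  Set.nonempty_iff_ne_empty.2 fun h => ha.1 (Subtype.ext h)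

theorem mem_finset_sup {F : Finset (SigmaFieldAlgebra X)} {x : X} :
    x ∈ ((F.sup id : SigmaFieldAlgebra X) : Set X) ↔ ∃ b ∈ F, x ∈ (b : Set X) := by
  classical
  induction F using Finset.induction_on with
  | empty => exact ⟨fun h => h.elim, by simp⟩
  | insert a F haF ih =>
    rw [Finset.sup_insert, Finset.exists_mem_insert, ← ih]
    rfl

theorem exists_finset_of_mem_ringSocle {f : measurableFunctionRing X}
    (hf : f ∈ ringSocle (measurableFunctionRing X)) :
    ∃ F : Finset (SigmaFieldAlgebra X), ∀ a, IsAtom a → a ∉ F → ∀ x ∈ (a : Set X),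
      (f : X → ℝ) x = 0 := by
  obtain ⟨F, hF, hle⟩ := mem_ringSocle.1 hf
  refine ⟨F, fun a ha haF x hx => ?_⟩
  by_contra h0
  obtain ⟨b, hb, hxb⟩ := mem_finset_sup.1 (hle (mem_coz.2 h0))
  exact haF (atom_eq ha (hF b hb) hx hxb ▸ hb)

theorem finite_setOf_isAtom
    (h : IsSelfInjectiveRing (measurableFunctionRing X ⧸ ringSocle (measurableFunctionRing X))) :
    {a : SigmaFieldAlgebra X | IsAtom a}.Finite := by
  by_contra hinf
  let e := Set.Infinite.natEmbedding _ hinf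
  -- Infinitely many atoms are arranged in a square array with rows `B m`. Modulo finitely many
  -- atoms `f` is 1 on each row, so every row has an atom where `f` is 1.
  let a : ℕ → ℕ → SigmaFieldAlgebra X := fun m n => e (Nat.pair m n)
  have ha : ∀ m n, IsAtom (a m n) := fun m n => (e (Nat.pair m n)).2
  have hinj : ∀ {m n m' n'}, a m n = a m' n' → m = m' ∧ n = n' := fun hmn =>
    Nat.pair_eq_pair.1 (e.injective (Subtype.ext hmn))
  let B : ℕ → SigmaFieldAlgebra X := fun m =>
    ⟨⋃ n, (a m n : Set X), MeasurableSet.iUnion fun n => (a m n).2⟩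
  obtain ⟨f, hf1, hf2⟩ := exists_of_isSelfInjectiveRing h (Set.range B)
  have hn : ∀ m, ∃ n, ∀ x ∈ (a m n : Set X), (f : X → ℝ) x = 1 := by
    intro m
    obtain ⟨F, hF⟩ := exists_finset_of_mem_ringSocle (hf1 (B m) ⟨m, rfl⟩)
    obtain ⟨n, hnF⟩ := Infinite.exists_notMem_finset
      (F.preimage (a m) fun n _ n' _ hnn => (hinj hnn).2)
    refine ⟨n, fun x hx => ?_⟩
    have h0 := hF _ (ha m n) (fun hmem => hnF (Finset.mem_preimage.2 hmem)) x hx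
    have hxB : x ∈ (B m : Set X) := Set.mem_iUnion.2 ⟨n, hx⟩
    rw [coe_sub_apply, coe_mul_apply, char_of_mem hxB, mul_one] at h0
    exact sub_eq_zero.1 h0
  choose n hn using hn
  -- This transversal meets each row in one atom, so `f` should kill it modulo the socle; yet `f` is
  -- 1 on all its infinitely many atoms.
  let C : SigmaFieldAlgebra X :=
    ⟨⋃ m, (a m (n m) : Set X), MeasurableSet.iUnion fun m => (a m (n m)).2⟩
  have hC : f * char C ∈ ringSocle (measurableFunctionRing X) := by
    refine hf2 C ?_
    rintro _ ⟨m, rfl⟩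
    refine mem_ringSocle.2 ⟨{a m (n m)}, by simpa using ha m (n m), fun x hx => ?_⟩
    rw [Finset.sup_singleton]
    have hx' := mem_coz.1 hx
    rw [coe_mul_apply] at hx'
    have hxC : x ∈ (C : Set X) := by
      by_contra hne
      exact hx' (by rw [char_of_notMem hne, zero_mul])
    have hxB : x ∈ (B m : Set X) := by
      by_contra hne
      exact hx' (by rw [char_of_notMem hne, mul_zero])
    obtain ⟨m', hm'⟩ := Set.mem_iUnion.1 hxC
    obtain ⟨k, hk⟩ := Set.mem_iUnion.1 hxB
    obtain ⟨rfl, -⟩ := hinj (atom_eq (ha _ _) (ha _ _) hm' hk)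
    exact hm'
  obtain ⟨F, hF⟩ := exists_finset_of_mem_ringSocle hC
  obtain ⟨m, hmF⟩ := Infinite.exists_notMem_finset
    (F.preimage (fun m => a m (n m)) fun m _ m' _ hmm => (hinj hmm).1)
  obtain ⟨x, hx⟩ := atom_nonempty (ha m (n m))
  have h0 := hF _ (ha m (n m)) (fun hmem => hmF (Finset.mem_preimage.2 hmem)) x hx
  have hxC : x ∈ (C : Set X) := Set.mem_iUnion.2 ⟨m, hx⟩
  rw [coe_mul_apply, char_of_mem hxC, hn m x hx, mul_one] at h0
  exact one_ne_zero h0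

theorem mem_ringSocle_of_finite (hfin : {a : SigmaFieldAlgebra X | IsAtom a}.Finite)
    {f : measurableFunctionRing X} :
    f ∈ ringSocle (measurableFunctionRing X) ↔
      ∀ x, x ∉ ((hfin.toFinset.sup id : SigmaFieldAlgebra X) : Set X) → (f : X → ℝ) x = 0 := by
  have hsub : (∀ x, x ∉ ((hfin.toFinset.sup id : SigmaFieldAlgebra X) : Set X) →
      (f : X → ℝ) x = 0) ↔ coz f ≤ hfin.toFinset.sup id :=
    forall_congr' fun x => not_imp_comm
  rw [mem_ringSocle, hsub]
  exact ⟨fun ⟨F, hF, hf⟩ => hf.trans (Finset.sup_mono fun a ha => by simpa using hF a ha),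
    fun hf => ⟨_, by simp, hf⟩⟩

theorem isCompleteBooleanAlgebra_of_isSelfInjectiveRing
    (h : IsSelfInjectiveRing (measurableFunctionRing X ⧸ ringSocle (measurableFunctionRing X))) :
    IsCompleteBooleanAlgebra (SigmaFieldAlgebra X) := by
  classical
  intro K _
  have hfin := finite_setOf_isAtom h
  obtain ⟨f, hf1, hf2⟩ := exists_of_isSelfInjectiveRing h K
  set A₀ : SigmaFieldAlgebra X := hfin.toFinset.sup id
  -- The quotient does not see `A₀`, so the atoms lying below members of `K` are added by hand.
  let G : Finset (SigmaFieldAlgebra X) := hfin.toFinset.filter fun a => ∃ B ∈ K, a ≤ B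
  refine ⟨coz f \ A₀ ⊔ G.sup id, fun B hB x hx => ?_, fun T hT => sup_le ?_ ?_⟩
  · by_cases hx0 : x ∈ (A₀ : Set X)
    · obtain ⟨a, ha, hxa⟩ := mem_finset_sup.1 hx0
      have haB := atom_le (hfin.mem_toFinset.1 ha) hxa hx
      exact Or.inr (mem_finset_sup.2 ⟨a, Finset.mem_filter.2 ⟨ha, B, hB, haB⟩, hxa⟩)
    · refine Or.inl ⟨mem_coz.2 fun h0 => ?_, hx0⟩
      have := (mem_ringSocle_of_finite hfin).1 (hf1 B hB) x hx0
      rw [coe_sub_apply, coe_mul_apply, char_of_mem hx, h0] at this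
      norm_num at this
  · rintro x ⟨hxf, hx0⟩
    by_contra hxT
    have hC := (mem_ringSocle_of_finite hfin).1 (hf2 Tᶜ fun B hB =>
      (mem_ringSocle_of_finite hfin).2 fun y _ => ?_) x hx0
    · have hxT' : x ∈ ((Tᶜ : SigmaFieldAlgebra X) : Set X) := hxT
      rw [coe_mul_apply, char_of_mem hxT', mul_one] at hC
      exact hxf hC
    · rw [coe_mul_apply]
      by_cases hy : y ∈ (B : Set X)
      · have hyT : y ∉ ((Tᶜ : SigmaFieldAlgebra X) : Set X) := fun hn => hn (hT hB hy)
        rw [char_of_notMem hyT, zero_mul]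
      · rw [char_of_notMem hy, mul_zero]
  · refine Finset.sup_le fun a ha => ?_
    obtain ⟨-, B, hB, haB⟩ := Finset.mem_filter.1 ha
    exact haB.trans (hT hB)

/-! ### Extending homomorphisms by gluing -/

theorem isSelfInjectiveRing_of_isCompleteBooleanAlgebra
    (hc : IsCompleteBooleanAlgebra (SigmaFieldAlgebra X))
    (hfin : {a : SigmaFieldAlgebra X | IsAtom a}.Finite) :
    IsSelfInjectiveRing (measurableFunctionRing X ⧸ ringSocle (measurableFunctionRing X)) := by
  intro I φ
  set A₀ : SigmaFieldAlgebra X := hfin.toFinset.sup id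
  let π := Ideal.Quotient.mk (ringSocle (measurableFunctionRing X))
  have hπ : ∀ f g, π f = π g ↔ ∀ x, x ∉ (A₀ : Set X) → (f : X → ℝ) x = (g : X → ℝ) x := by
    intro f g
    rw [Ideal.Quotient.eq, mem_ringSocle_of_finite hfin]
    exact forall₂_congr fun x _ => by rw [coe_sub_apply, sub_eq_zero]
  let 𝒦 := {B : SigmaFieldAlgebra X // π (char B) ∈ I}
  have hrep : ∀ B : 𝒦, ∃ f, π f = φ ⟨π (char B.1), B.2⟩ := fun B =>
    Ideal.Quotient.mk_surjective _
  choose f hf using hrep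
  have hsmul : ∀ (r : measurableFunctionRing X) (B : 𝒦) (hr : π (r * char B.1) ∈ I),
      φ ⟨π (r * char B.1), hr⟩ = π (r * f B) := by
    intro r B hr
    refine Eq.trans ?_ (map_mul π r (f B)).symm
    rw [hf]
    exact (congrArg φ (Subtype.ext (map_mul π r (char B.1)))).trans
      (φ.map_smul (π r) ⟨π (char B.1), B.2⟩)
  obtain ⟨F, hF, hFB⟩ := hc.exists_measurable_glue (fun B : 𝒦 => (B.1 : Set X) \ A₀)
    -- Compatibility comes from evaluating `φ` on the product of two characteristic functions in
    -- both ways; the resulting equality in the quotient is pointwise off `A₀`.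
    (fun B => B.1.2.diff A₀.2) (fun B => (f B : X → ℝ)) (fun B => measurable_coe _) (by
      rintro B C x ⟨hxB, hx0⟩ ⟨hxC, -⟩
      have hmem : π (char C.1 * char B.1) ∈ I := by
        rw [map_mul]
        exact I.mul_mem_left _ B.2
      have hmem' : π (char B.1 * char C.1) ∈ I := by
        rw [map_mul]
        exact I.mul_mem_left _ C.2
      have heq : π (char C.1 * f B) = π (char B.1 * f C) := by
        rw [← hsmul _ _ hmem, ← hsmul _ _ hmem']
        exact congrArg φ (Subtype.ext (congrArg π (mul_comm _ _)))
      have := (hπ _ _).1 heq x hx0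
      rwa [coe_mul_apply, coe_mul_apply, char_of_mem hxB, char_of_mem hxC, one_mul,
        one_mul] at this)
  refine ⟨LinearMap.mulLeft _ (π (ofMeasurable F hF)), fun q hq => ?_⟩
  obtain ⟨g, rfl⟩ := Ideal.Quotient.mk_surjective q
  -- The pointwise inverse puts the characteristic function of `coz g` in the ideal, so `φ` at `g`
  -- is determined by a local function.
  let B : 𝒦 := ⟨coz g, by
    rw [← mul_pinv_eq_char, map_mul]
    exact I.mul_mem_right _ hq⟩
  have hgB : g * char B.1 = g := mul_char_eq_self le_rfl
  have hmem : π (g * char B.1) ∈ I := by rwa [hgB]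
  have hval : φ ⟨π g, hq⟩ = π (g * f B) := by
    rw [← hsmul g B hmem]
    exact congrArg φ (Subtype.ext (congrArg π hgB.symm))
  refine Eq.trans ?_ hval.symm
  rw [LinearMap.mulLeft_apply]
  refine (map_mul π _ g).symm.trans ((hπ _ _).2 fun x hx0 => ?_)
  rw [coe_mul_apply, coe_mul_apply, mul_comm]
  by_cases hx : x ∈ (coz g : Set X)
  · exact congrArg _ (hFB B x ⟨hx, hx0⟩)
  · rw [not_not.1 hx, zero_mul, zero_mul]

end measurableFunctionRing

end FunctionRing

theorem theorem4p9 (X : Type u) [MeasurableSpace X] :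
    IsSelfInjectiveRing
        (measurableFunctionRing X ⧸ ringSocle (measurableFunctionRing X)) ↔
      IsCompleteBooleanAlgebra (SigmaFieldAlgebra X) ∧
        IsSuccAdditive X Cardinal.continuum.{u} ∧
        {a : SigmaFieldAlgebra X | IsAtom a}.Finite := by
  refine ⟨fun h => ?_, fun ⟨hc, _, hfin⟩ =>
    measurableFunctionRing.isSelfInjectiveRing_of_isCompleteBooleanAlgebra hc hfin⟩
  have hc := measurableFunctionRing.isCompleteBooleanAlgebra_of_isSelfInjectiveRing h
  exact ⟨hc, hc.isSuccAdditive_continuum, measurableFunctionRing.finite_setOf_isAtom h⟩
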